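/- A digraph $\Gamma$ on the vertex set $\{1,\dots,n\}$ may have multiple edges and loops; $\deg(i,j)\in\mathbb Z_{\ge 0}$ denotes the number of edges from $i$ to $j$, and $\operatorname{outdeg}(i)=\sum_{j}\deg(i,j)$. Its Laplacian is the integer $n\times n$ matrix $L$ with $L_{ij}=-\deg(i,j)$ for $i\neq j$ and $L_{ii}=\operatorname{outdeg}(i)-\deg(i,i)$. The rows of $L$ lie in the group $\mathbb Z^n_0$ of integer vectors whose entries sum to zero, and the total sandpile group of $\Gamma$ is $S(\Gamma)=\mathbb Z^n_0/\mathbb Z^nL$, where $\mathbb Z^nL=\{vL : v\in\mathbb Z^n\}$ ($v$ a row vector) is the subgroup generated by the rows of $L$. For $\epsilon>0$, a random digraph $\Gamma$ is called $\epsilon$-balanced if the random variables $\deg(i,j)$, over all ordered pairs of distinct vertices $i\ne j$, are independent and satisfy $\mathbb P(\deg(i,j)\equiv r \pmod p)\le 1-\epsilon$ for every prime $p$ and every $r\in\mathbb Z/p\mathbb Z$. The variables need not be identically distributed, and no condition is placed on the numbers of loops $\deg(i,i)$. **Theorem 3.1.** Let $a$ be a positive integer, let $\epsilon>0$, and let $G$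 be a finite abelian group whose exponent divides $a$. Then there exist constants $K,c>0$, depending only on $a$, $\epsilon$ and $G$, such that for every $n\ge 0$ and every $\epsilon$-balanced random digraph $\Gamma$ on $n$ vertices, with $S=S(\Gamma)$, the number $\#\operatorname{Sur}(S,G)$ of surjective group homomorphisms $S\to G$ has finite expectation and $$\left|\mathbb E\bigl(\#\operatorname{Sur}(S,G)\bigr)-\frac1{|G|}\right|\le K e^{-cn}.$$ -/

import Mathlib

open MeasureTheory ProbabilityTheory

/-- A directed graph on the vertex set `V` with multiple edges and loops permitted, recorded by
the number `deg i j` of edges from `i` to `j`. -/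
structure MultiDigraph (V : Type*) where
  deg : V → V → ℕ

namespace MultiDigraph

variable {V : Type*} [Fintype V]

/-- The number of edges leaving the vertex `i` (loops included). -/
def outdeg (Γ : MultiDigraph V) (i : V) : ℕ := ∑ j, Γ.deg i j

/-- The laplacian: `L i j = -deg i j` for `i ≠ j` and `L i i = outdeg i - deg i i`.
All its rows sum to zero. -/
def laplacian [DecidableEq V] (Γ : MultiDigraph V) : Matrix V V ℤ :=
  Matrix.of fun i j => if i = j then (Γ.outdeg i : ℤ) - Γ.deg i i else -(Γ.deg i j : ℤ)

/-- The integer vectors whose entries sum to zero. -/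
def sumZero (V : Type*) [Fintype V] : Submodule ℤ (V → ℤ) where
  carrier := {x | ∑ i, x i = 0}
  add_mem' {x y} hx hy := by
    simp only [Set.mem_ofPred_eq] at hx hy ⊢
    simp [Finset.sum_add_distrib, hx, hy]
  zero_mem' := by simp
  smul_mem' k x hx := by
    simp only [Set.mem_ofPred_eq] at hx ⊢
    simp [← Finset.mul_sum, hx]

/-- The image of `ℤ^V` under the laplacian, whose row `i` is the effect (up to sign) of firing
the vertex `i`: the set of integer combinations `v ᵥ* L` of the rows of `L`. -/
def laplacianImage [DecidableEq V] (Γ : MultiDigraph V) : Submodule ℤ (V → ℤ) :=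
  LinearMap.range Γ.laplacian.vecMulLinear

/-- The image of the laplacian consists of vectors with entries summing to zero. -/
theorem laplacianImage_le_sumZero [DecidableEq V] (Γ : MultiDigraph V) :
    Γ.laplacianImage ≤ sumZero V := by
  rintro _ ⟨v, rfl⟩
  change ∑ j, ∑ i, v i * Γ.laplacian i j = 0
  rw [Finset.sum_comm]
  refine Finset.sum_eq_zero fun i _ => ?_
  rw [← Finset.mul_sum, ← Finset.add_sum_erase _ _ (Finset.mem_univ i)]
  have h : ∑ j ∈ Finset.univ.erase i, Γ.laplacian i j
      = -∑ j ∈ Finset.univ.erase i, (Γ.deg i j : ℤ) := by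
    rw [← Finset.sum_neg_distrib]
    refine Finset.sum_congr rfl fun j hj => ?_
    simp [laplacian, (Finset.ne_of_mem_erase hj).symm]
  have h2 : (Γ.outdeg i : ℤ) = Γ.deg i i + ∑ j ∈ Finset.univ.erase i, (Γ.deg i j : ℤ) := by
    rw [outdeg, Nat.cast_sum, ← Finset.add_sum_erase _ _ (Finset.mem_univ i)]
  rw [h]
  simp [laplacian, h2]

/-- The total sandpile group: the quotient of the group of integer vectors with entry sum zero
by the image of the laplacian (which lies in it). -/
abbrev TotalSandpile [DecidableEq V] (Γ : MultiDigraph V) : Type _ :=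
  sumZero V ⧸ Γ.laplacianImage.submoduleOf (sumZero V)

end MultiDigraph

/-- The random variable `y` in the commutative ring `T` is `ε`-balanced: modulo every maximal
ideal, every residue class has probability at most `1 - ε`. -/
def IsBalanced {Ω : Type*} [MeasurableSpace Ω] {T : Type*} [CommRing T]
    (ε : ℝ) (y : Ω → T) (μ : Measure Ω) : Prop :=
  ∀ 𝔭 : Ideal T, 𝔭.IsMaximal → ∀ r : T ⧸ 𝔭,
    μ.real {ω | Ideal.Quotient.mk 𝔭 (y ω) = r} ≤ 1 - ε

/-- An `ε`-balanced random digraph: all edge multiplicities are random variables, and those at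
the pairs of distinct vertices are independent and `ε`-balanced over `ℤ`. -/
structure IsBalancedDigraph {Ω : Type*} [MeasurableSpace Ω] {V : Type*}
    (ε : ℝ) (Γ : Ω → MultiDigraph V) (μ : Measure Ω) : Prop where
  measurable : ∀ i j : V, Measurable fun ω => (Γ ω).deg i j
  indep : iIndepFun (fun (e : {e : V × V // e.1 ≠ e.2}) (ω : Ω) =>
    (Γ ω).deg e.1.1 e.1.2) μ
  balanced : ∀ i j : V, i ≠ j → IsBalanced ε (fun ω => ((Γ ω).deg i j : ℤ)) μ

/-- The number of surjective homomorphisms `S → G`. (For finitely generated `S` and finite `G`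
there are finitely many homomorphisms.) -/
noncomputable def numSur (S G : Type*) [AddCommGroup S] [AddCommGroup G] : ℕ :=
  Nat.card {f : S →+ G // Function.Surjective f}

/-! Fix a base vertex. A surjection from the sandpile group to `G`, together with a base value in
`G`, is a vector f in G^n that the Laplacian annihilates and along which no nontrivial character is
constant (`IsSpread`, `numSur_mul_card`). This is where the factor 1/|G| comes from.

Rows are independent, so Fourier inversion on `G` writes the probability that the Laplacian
annihilates f as |G|^(-n) ∏ q_i(f), where q_i is a sum over characters ψ of products of
expectations. Hence |G| · E(#Sur) is the average of ∏ q_i(f) over G^n, with non-spread f counted as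
0. The trivial character contributes 1 to q_i. By balancedness each other ψ contributes at most ρ^k,
where k counts the j with ψ(f j) ≠ ψ(f i) and ρ < 1 depends only on `G` and ε
(`exists_norm_integral_addChar_le`).

It remains to show that this average is exponentially close to 1 (`exists_norm_average_sub_one_le`).
Let A be the set of characters constant along f up to D = δn exceptions. If A is trivial, each q_i
is 1 + O(ρ^D) and so ∏ q_i is close to 1. Otherwise all but |G|D entries of f lie in one fibre of A,
of size at most |G|/#A. At these entries q_i ≤ #A(1 - κ), since spreadness costs each nontrivial ψ
in A a factor ρ. The gain 1 - κ in each coordinate beats the entropy of the few exceptional entries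
once δ is small (`norm_ite_prod_sub_one_le`). -/

/-! ### Character expectations of balanced variables. -/

/-- A function of a balanced variable that separates the residue classes modulo a prime takes
every value with probability at most `1 - ε`. -/
theorem IsBalanced.measureReal_eq_le {Ω : Type*} [MeasurableSpace Ω] {μ : Measure Ω}
    [IsProbabilityMeasure μ] {ε : ℝ} {y : Ω → ℕ} (hy : IsBalanced ε (fun ω => (y ω : ℤ)) μ)
    {β : Type*} {f : ℕ → β} {p : ℕ} (hp : p.Prime) (hf : ∀ a b, f a = f b → a ≡ b [MOD p])
    (v : β) : μ.real {ω | f (y ω) = v} ≤ 1 - ε := by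
  have hmax : (Ideal.span {(p : ℤ)}).IsMaximal :=
    PrincipalIdealRing.isMaximal_of_irreducible (Nat.prime_iff_prime_int.mp hp).irreducible
  by_cases h : ∃ b, f b = v
  · obtain ⟨b, rfl⟩ := h
    refine le_trans (measureReal_mono ?_) (hy _ hmax (Ideal.Quotient.mk _ (b : ℤ)))
    intro ω hω
    have h1 := hf _ _ hω
    simp only [Set.mem_ofPred_eq]
    rw [Ideal.Quotient.eq, Ideal.mem_span_singleton]
    exact (Nat.modEq_iff_dvd.mp h1.symm)
  · have : {ω | f (y ω) = v} = ∅ := by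
      ext ω
      simp only [Set.mem_ofPred_eq, Set.mem_empty_iff_false, iff_false]
      exact fun h' => h ⟨_, h'⟩
    rw [this, measureReal_empty]
    -- Balancedness at any one residue class already forces 0 ≤ 1 - ε.
    exact le_trans measureReal_nonneg (hy _ hmax 0)

/-- The powers of a nontrivial character value separate residue classes modulo some prime. -/
theorem AddChar.exists_prime_nsmul_modEq {G : Type*} [AddCommGroup G] [Finite G]
    (ψ : AddChar G ℂ) {g : G} (hg : ψ g ≠ 1) :
    ∃ p : ℕ, p.Prime ∧ ∀ a b : ℕ, ψ (a • g) = ψ (b • g) → a ≡ b [MOD p] := by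
  have h0 : ψ g ≠ 0 := by
    intro h
    have := ψ.norm_apply g
    simp [h] at this
  set u : ℂˣ := Units.mk0 (ψ g) h0 with hu
  have hu1 : u ≠ 1 := fun h => hg (by simpa [hu] using congrArg Units.val h)
  have hne : orderOf u ≠ 1 := by rwa [Ne, orderOf_eq_one_iff]
  refine ⟨(orderOf u).minFac, Nat.minFac_prime hne, fun a b hab => ?_⟩
  rw [AddChar.map_nsmul_eq_pow, AddChar.map_nsmul_eq_pow] at hab
  have : u ^ a = u ^ b := Units.ext (by simpa [hu] using hab)
  exact (pow_eq_pow_iff_modEq.mp this).of_dvd (Nat.minFac_dvd _)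

/-- Among finitely many points, at most one is very close to being parallel to a given unit
vector. -/
theorem exists_forall_re_conj_mul_le (s : Set ℂ) (hs : s.Finite) (hs1 : ∀ z ∈ s, ‖z‖ = 1) :
    ∃ κ : ℝ, 0 < κ ∧ ∀ u : ℂ, ‖u‖ = 1 →
      ∃ v : ℂ, ∀ z ∈ s, z ≠ v → (starRingEnd ℂ u * z).re ≤ 1 - κ := by
  obtain ⟨d, hd, hsep⟩ : ∃ d : ℝ, 0 < d ∧ ∀ z ∈ s, ∀ w ∈ s, z ≠ w → d ≤ ‖z - w‖ := by
    by_cases hne : ((s ×ˢ s) \ {q | q.1 = q.2}).Nonempty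
    · obtain ⟨q, hq, hmin⟩ := ((hs.prod hs).subset Set.sdiff_subset).exists_minimalFor
        (fun q : ℂ × ℂ => ‖q.1 - q.2‖) _ hne
      refine ⟨‖q.1 - q.2‖, norm_pos_iff.mpr (sub_ne_zero.mpr hq.2), fun z hz w hw hzw => ?_⟩
      by_contra! hlt
      exact absurd (hmin (j := (z, w)) ⟨⟨hz, hw⟩, hzw⟩ hlt.le) (not_le.mpr hlt)
    · refine ⟨1, one_pos, fun z hz w hw hzw => ?_⟩
      exact absurd ⟨(z, w), ⟨hz, hw⟩, hzw⟩ hne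
  -- As |z - u|² = 2 - 2 Re(ū z), this constant puts every exceptional z within d/2 of u, and two
  -- distinct points cannot both be that close.
  refine ⟨d ^ 2 / 8, by positivity, fun u hu => ?_⟩
  have key : ∀ z ∈ s, 1 - d ^ 2 / 8 < (starRingEnd ℂ u * z).re → ‖z - u‖ < d / 2 := by
    intro z hz h
    have h1 : ‖z - u‖ ^ 2 = 2 - 2 * (starRingEnd ℂ u * z).re := by
      have hz1 : Complex.normSq z = 1 := by rw [Complex.normSq_eq_norm_sq, hs1 z hz]; norm_num
      have hu1 : Complex.normSq u = 1 := by rw [Complex.normSq_eq_norm_sq, hu]; norm_num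
      rw [← Complex.normSq_eq_norm_sq, Complex.normSq_sub, hz1, hu1,
        mul_comm (starRingEnd ℂ u) z]
      norm_num
    nlinarith [norm_nonneg (z - u)]
  by_cases hv : ∃ v ∈ s, 1 - d ^ 2 / 8 < (starRingEnd ℂ u * v).re
  · obtain ⟨v, hvs, hv⟩ := hv
    refine ⟨v, fun z hz hzv => ?_⟩
    by_contra! hlt
    have h1 := key z hz hlt
    have h2 := key v hvs hv
    have h3 := hsep z hz v hvs hzv
    have h4 : ‖z - v‖ ≤ ‖z - u‖ + ‖v - u‖ := by
      rw [norm_sub_rev v u]; exact norm_sub_le_norm_sub_add_norm_sub z u v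
    linarith
  · push Not at hv
    exact ⟨0, fun z hz _ => hv z hz⟩

/-- Characters of a finite group have uniformly small expectation at the multiples of an element
by a balanced variable, unless the character is trivial at the element. -/
theorem exists_norm_integral_addChar_le (G : Type*) [AddCommGroup G] [Finite G] {ε : ℝ}
    (hε : 0 < ε) : ∃ ρ : ℝ, 0 < ρ ∧ ρ < 1 ∧
      ∀ (Ω : Type*) [MeasurableSpace Ω] (μ : Measure Ω) [IsProbabilityMeasure μ] (y : Ω → ℕ),
        Measurable y → IsBalanced ε (fun ω => (y ω : ℤ)) μ →
        ∀ (ψ : AddChar G ℂ) (g : G), ψ g ≠ 1 → ‖∫ ω, ψ (y ω • g) ∂μ‖ ≤ ρ := by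
  have hfin : (Set.range fun q : AddChar G ℂ × G => q.1 q.2).Finite := Set.finite_range _
  obtain ⟨κ, hκ, hsep⟩ := exists_forall_re_conj_mul_le _ hfin
    (by rintro _ ⟨q, rfl⟩; exact q.1.norm_apply q.2)
  -- The maximum with 1/2 only keeps the bound positive when ε is large.
  refine ⟨max (1 / 2) (1 - κ * ε), by positivity, max_lt (by norm_num) (by nlinarith), ?_⟩
  intro Ω _ μ _ y hy hbal ψ g hg
  refine le_max_of_le_right ?_
  set I := ∫ ω, ψ (y ω • g) ∂μ with hI
  -- Rotating by the phase u of the integral turns its norm into the integral of a real part, which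
  -- is at most 1 - κ off the event `A` that the character takes the one value v.
  obtain ⟨u, hu, huI⟩ : ∃ u : ℂ, ‖u‖ = 1 ∧ starRingEnd ℂ u * I = ‖I‖ := by
    by_cases hI0 : I = 0
    · exact ⟨1, by simp, by simp [hI0]⟩
    · have h0 : (‖I‖ : ℂ) ≠ 0 := by simpa using hI0
      refine ⟨I / ‖I‖, by simp [hI0], ?_⟩
      rw [map_div₀, Complex.conj_ofReal, div_mul_eq_mul_div, mul_comm, Complex.mul_conj,
        Complex.normSq_eq_norm_sq, div_eq_iff h0]
      push_cast
      ring
  obtain ⟨p, hp, hmod⟩ := ψ.exists_prime_nsmul_modEq hg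
  obtain ⟨v, hv⟩ := hsep u hu
  set A := {ω | ψ (y ω • g) = v} with hA
  have h1 : μ.real A ≤ 1 - ε := hbal.measureReal_eq_le hp hmod v
  have hmA : MeasurableSet A := by
    have : A = y ⁻¹' {k | ψ (k • g) = v} := rfl
    rw [this]
    exact hy (MeasurableSet.of_discrete)
  have hmeas : Measurable fun ω => ψ (y ω • g) :=
    (measurable_from_nat (f := fun k : ℕ => ψ (k • g))).comp hy
  have hint : Integrable (fun ω => ψ (y ω • g)) μ :=
    Integrable.of_bound hmeas.aestronglyMeasurable 1 (by simp [ψ.norm_apply])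
  have h2 : ‖I‖ = ∫ ω, (starRingEnd ℂ u * ψ (y ω • g)).re ∂μ := by
    have h3 : starRingEnd ℂ u * I = ∫ ω, starRingEnd ℂ u * ψ (y ω • g) ∂μ := by
      rw [hI, integral_const_mul]
    have h4 := integral_re (hint.const_mul (starRingEnd ℂ u))
    simp only [RCLike.re_eq_complex_re] at h4
    rw [h4, ← h3, huI, Complex.ofReal_re]
  have hint' : Integrable (fun ω => (starRingEnd ℂ u * ψ (y ω • g)).re) μ :=
    (hint.const_mul (starRingEnd ℂ u)).re
  have hindI : Integrable (A.indicator fun _ => κ) μ := (integrable_const κ).indicator hmA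
  calc ‖I‖ = ∫ ω, (starRingEnd ℂ u * ψ (y ω • g)).re ∂μ := h2
    _ ≤ ∫ ω, ((1 - κ) + A.indicator (fun _ => κ) ω) ∂μ := by
        refine integral_mono hint' ((integrable_const _).add hindI) fun ω => ?_
        by_cases hω : ω ∈ A
        · have : (starRingEnd ℂ u * ψ (y ω • g)).re ≤ ‖starRingEnd ℂ u * ψ (y ω • g)‖ :=
            Complex.re_le_norm _
          rw [norm_mul, ψ.norm_apply, RCLike.norm_conj, hu, one_mul] at this
          simpa [hω] using this
        · simpa [hω] using hv _ ⟨(ψ, y ω • g), rfl⟩ hω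
    _ = 1 - κ + μ.real A * κ := by
        rw [integral_add (integrable_const _) hindI, integral_indicator_const _ hmA]
        simp
    _ ≤ 1 - κ * ε := by nlinarith

/-! ### Fourier expansion of the row relations. -/

theorem AddChar.map_sum_eq_prod {A M ι : Type*} [AddCommMonoid A] [CommMonoid M]
    (ψ : AddChar A M) (s : Finset ι) (g : ι → A) : ψ (∑ i ∈ s, g i) = ∏ i ∈ s, ψ (g i) := by
  classical
  induction s using Finset.induction_on with
  | empty => simp
  | insert i s hi ih => rw [Finset.sum_insert hi, Finset.prod_insert hi, ψ.map_add_eq_mul, ih]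

theorem measurableSet_forall_sum_nsmul_eq_zero {V G Ω : Type*} [Fintype V]
    [AddCommGroup G] [MeasurableSpace Ω]
    {y : V → V → Ω → ℕ} (hy : ∀ i j, Measurable (y i j)) (f : V → G) :
    MeasurableSet {ω | ∀ i, ∑ j, y i j ω • (f i - f j) = 0} := by
  have : {ω | ∀ i, ∑ j, y i j ω • (f i - f j) = 0}
      = (fun ω i j => y i j ω) ⁻¹' {m : V → V → ℕ | ∀ i, ∑ j, m i j • (f i - f j) = 0} := rfl
  rw [this]
  exact (measurable_pi_lambda _ fun i => measurable_pi_lambda _ fun j => hy i j)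
    (Set.to_countable _).measurableSet

/-- The probability that all rows of a balanced random matrix with independent off-diagonal
entries annihilate the differences of `f`, in terms of character expectations. -/
theorem integral_indicator_forall_sum_eq_zero {V G Ω : Type*} [Fintype V] [DecidableEq V]
    [AddCommGroup G] [Fintype G] [MeasurableSpace Ω] {μ : Measure Ω} [IsProbabilityMeasure μ]
    {y : V → V → Ω → ℕ} (hy : ∀ i j, Measurable (y i j))
    (hind : iIndepFun (fun (e : {e : V × V // e.1 ≠ e.2}) => y e.1.1 e.1.2) μ) (f : V → G) :
    ((μ.real {ω | ∀ i, ∑ j, y i j ω • (f i - f j) = 0} : ℝ) : ℂ)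
      = ∏ i, ((Fintype.card G : ℂ)⁻¹ *
          ∑ ψ : AddChar G ℂ, ∏ j, ∫ ω, ψ (y i j ω • (f i - f j)) ∂μ) := by
  classical
  have hmeas : ∀ (ψ : AddChar G ℂ) i j, Measurable fun ω => ψ (y i j ω • (f i - f j)) :=
    fun ψ i j => (measurable_from_nat (f := fun k : ℕ => ψ (k • (f i - f j)))).comp (hy i j)
  set E := {ω | ∀ i, ∑ j, y i j ω • (f i - f j) = 0} with hE
  have hpt : ∀ ω, E.indicator (fun _ => (1 : ℂ)) ω
      = ∏ i, ((Fintype.card G : ℂ)⁻¹ * ∑ ψ : AddChar G ℂ, ∏ j, ψ (y i j ω • (f i - f j))) := by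
    intro ω
    have hcard : (Fintype.card G : ℂ) ≠ 0 := by simp
    have : ∀ i, ((Fintype.card G : ℂ)⁻¹ * ∑ ψ : AddChar G ℂ, ∏ j, ψ (y i j ω • (f i - f j)))
        = if ∑ j, y i j ω • (f i - f j) = 0 then 1 else 0 := by
      intro i
      have h := AddChar.sum_apply_eq_ite (∑ j, y i j ω • (f i - f j))
      simp_rw [AddChar.map_sum_eq_prod] at h
      rw [h]
      split_ifs <;> simp [hcard]
    simp_rw [this, Finset.prod_ite_zero]
    by_cases hω : ω ∈ E
    · have hω' := hω
      simp only [hE, Set.mem_ofPred_eq] at hω'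
      simp [hω, hω']
    · have hω' := hω
      simp only [hE, Set.mem_ofPred_eq] at hω'
      simp only [hω, not_false_eq_true, Set.indicator_of_notMem, Finset.mem_univ, forall_const]
      rw [if_neg hω']
  have hEm : MeasurableSet E := measurableSet_forall_sum_nsmul_eq_zero hy f
  -- Diagonal factors equal 1 because f i - f i = 0, so independence of the off-diagonal entries
  -- suffices.
  have hprod : ∀ c : V → V → ℂ, (∀ i, c i i = 1) →
      ∏ e : {e : V × V // e.1 ≠ e.2}, c e.1.1 e.1.2 = ∏ i, ∏ j, c i j := by
    intro c hc
    rw [← Fintype.prod_prod_type', ← Finset.prod_subtype (Finset.univ.filter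
      fun e : V × V => e.1 ≠ e.2) (by simp) (fun e : V × V => c e.1 e.2)]
    refine Finset.prod_filter_of_ne fun e _ he h => he ?_
    rw [h, hc]
  have hexp : ∀ Ψ : V → AddChar G ℂ, ∫ ω, ∏ i, ∏ j, Ψ i (y i j ω • (f i - f j)) ∂μ
      = ∏ i, ∏ j, ∫ ω, Ψ i (y i j ω • (f i - f j)) ∂μ := by
    intro Ψ
    rw [← hprod _ (by simp)]
    simp_rw [fun ω => (hprod (fun i j => Ψ i (y i j ω • (f i - f j))) (by simp)).symm]
    exact hind.integral_fun_prod_comp (fun e => (hy _ _).aemeasurable)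
      (f := fun e k => Ψ e.1.1 (k • (f e.1.1 - f e.1.2)))
      (fun e => measurable_from_nat.aestronglyMeasurable)
  have h1 : ((μ.real E : ℝ) : ℂ) = ∫ ω, E.indicator (fun _ => (1 : ℂ)) ω ∂μ := by
    rw [integral_indicator_const _ hEm]
    simp
  rw [h1]
  -- Expanding the product of sums picks one character Ψ i for each row.
  simp_rw [hpt, Finset.prod_mul_distrib, Finset.prod_univ_sum]
  rw [integral_const_mul, integral_finsetSum]
  · simp_rw [hexp]
  · intro Ψ _
    refine Integrable.of_bound (C := 1) ?_ (by simp [AddChar.norm_apply])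
    exact (Finset.measurable_prod _ fun i _ => Finset.measurable_prod _
      fun j _ => hmeas _ _ _).aestronglyMeasurable

/-! ### Fibres of sets of characters and their weights. -/

section Combinatorics

open Finset

variable {G : Type*} [AddCommGroup G]

/-- No nontrivial character of `G` is constant along the vector `f`. -/
def IsSpread {V : Type*} (f : V → G) : Prop :=
  ∀ ψ : AddChar G ℂ, ψ ≠ 0 → ∃ j k, ψ (f j) ≠ ψ (f k)

variable [Fintype G]

/-- A fibre common to a set `A` of characters has at most `|G| / |A|` elements. -/
theorem AddChar.card_fibre_mul_card_le [DecidableEq G] (A : Finset (AddChar G ℂ)) (g : G) :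
    #{x : G | ∀ ψ ∈ A, ψ x = ψ g} * #A ≤ Fintype.card G := by
  classical
  -- The fibre lies in a coset of the annihilator `B` of A, and A embeds in the dual of G/B.
  let B : AddSubgroup G :=
    { carrier := {x | ∀ ψ ∈ A, ψ x = 1}
      zero_mem' := by simp
      add_mem' := by
        intro x y hx hy ψ hψ
        rw [ψ.map_add_eq_mul, hx ψ hψ, hy ψ hψ, one_mul]
      neg_mem' := by
        intro x hx ψ hψ
        rw [ψ.map_neg_eq_inv, hx ψ hψ, inv_one] }
  have h1 : #{x : G | ∀ ψ ∈ A, ψ x = ψ g} ≤ Nat.card B := by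
    rw [Nat.card_eq_fintype_card, Fintype.card_subtype]
    refine Finset.card_le_card_of_injOn (fun x => x - g) ?_ (fun x _ y _ h => by simpa using h)
    intro x hx
    have hx' : ∀ ψ ∈ A, ψ x = ψ g := by simpa using hx
    simp only [coe_filter, mem_univ, true_and, Set.mem_ofPred_eq]
    intro ψ hψ
    rw [ψ.map_sub_eq_div, hx' ψ hψ, div_self]
    intro h0
    have := ψ.norm_apply g
    simp [h0] at this
  have hlift : ∀ ψ ∈ A, ∃ χ : AddChar (G ⧸ B) ℂ, ∀ x : G, χ (QuotientAddGroup.mk x) = ψ x := by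
    intro ψ hψ
    refine ⟨AddChar.toAddMonoidHomEquiv.symm
      (QuotientAddGroup.lift B ψ.toAddMonoidHom fun x hx => hx ψ hψ), fun x => rfl⟩
  choose! L hL using hlift
  have h2 : #A ≤ Nat.card (G ⧸ B) := by
    rw [Nat.card_eq_fintype_card, ← AddChar.card_eq (α := G ⧸ B), ← Finset.card_univ]
    refine Finset.card_le_card_of_injOn L (fun _ _ => mem_coe.2 (mem_univ _)) ?_
    intro ψ hψ χ hχ h
    ext x
    rw [← hL ψ hψ, ← hL χ hχ, h]
  rw [← Nat.card_eq_fintype_card, B.card_eq_card_quotient_mul_card_addSubgroup, mul_comm]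
  exact Nat.mul_le_mul h2 h1

open Classical in
/-- The weight comparing a vector with the fibre of `g` under the characters in `A`. -/
noncomputable def fibreWeight (κ t : ℝ) (A : Finset (AddChar G ℂ)) (g x : G) : ℝ :=
  if ∀ ψ ∈ A, ψ x = ψ g then #A * (1 - κ) else Fintype.card G / t

theorem fibreWeight_nonneg {κ t : ℝ} (hκ : κ ≤ 1) (ht : 0 ≤ t) (A : Finset (AddChar G ℂ))
    (g x : G) : 0 ≤ fibreWeight κ t A g x := by
  unfold fibreWeight
  split_ifs
  · exact mul_nonneg (by positivity) (by linarith)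
  · positivity

/-- The sum over vectors is the n-th power of the sum over one coordinate. At most |G|/#A elements
lie in the fibre, each of weight #A(1 - κ); at most |G| others have weight |G|/t. -/
theorem sum_prod_fibreWeight_le {κ t : ℝ} (hκ : κ ≤ 1) (ht : 0 < t) (A : Finset (AddChar G ℂ))
    (g : G) (n : ℕ) :
    ∑ f : Fin n → G, ∏ j, fibreWeight κ t A g (f j)
      ≤ (Fintype.card G * (1 - κ + Fintype.card G / t)) ^ n := by
  classical
  rw [← Fintype.sum_pow]
  refine pow_le_pow_left₀ (sum_nonneg fun x _ => fibreWeight_nonneg hκ ht.le A g x) ?_ n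
  unfold fibreWeight
  rw [sum_ite, sum_const, sum_const, nsmul_eq_mul, nsmul_eq_mul, mul_add, ← mul_assoc]
  refine add_le_add (mul_le_mul_of_nonneg_right ?_ (by linarith))
    (mul_le_mul_of_nonneg_right ?_ (by positivity))
  · exact_mod_cast AddChar.card_fibre_mul_card_le A g
  · exact_mod_cast card_le_univ _

open Classical in
/-- A vector spread over `G` on which exactly the characters in `A` are nearly constant: the
product of the row factors is controlled by the fibre weights. -/
theorem prod_le_prod_fibreWeight {n : ℕ} {ρ t D E : ℝ} (hρ : 0 < ρ) (hρ1 : ρ < 1) (ht : 1 ≤ t)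
    {f : Fin n → G} (hf : IsSpread f) {A : Finset (AddChar G ℂ)} (h0 : 0 ∈ A) (hA : 2 ≤ #A)
    (hfar : ∀ ψ ∉ A, ∀ v, D < #{j | ψ (f j) ≠ v}) {g : G}
    (hg : (#{j | ¬ ∀ ψ ∈ A, ψ (f j) = ψ g} : ℝ) ≤ E)
    (hD : Fintype.card G * ρ ^ D ≤ (1 - ρ) / 4) {q : Fin n → ℝ} (hq0 : ∀ i, 0 ≤ q i)
    (hq : ∀ i, q i ≤ 1 + ∑ ψ ∈ univ.erase (0 : AddChar G ℂ), ρ ^ #{j | ψ (f j) ≠ ψ (f i)}) :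
    ∏ i, q i ≤ t ^ E * ∏ j, fibreWeight ((1 - ρ) / 4) t A g (f j) := by
  -- Outside the fibre the trivial bound |G| suffices. The weight carries it discounted by 1/t, and
  -- each of the at most E such indices repays a factor t.
  have hle : ∀ i, q i ≤ fibreWeight ((1 - ρ) / 4) t A g (f i)
      * (if ∀ ψ ∈ A, ψ (f i) = ψ g then 1 else t) := by
    intro i
    refine (hq i).trans ?_
    unfold fibreWeight
    split_ifs with hi
    -- A character in A has at least one exception by spreadness and so costs a factor ρ; one
    -- outside A has more than D exceptions.
    · have h1 : ∀ ψ ∈ univ.erase (0 : AddChar G ℂ), ρ ^ #{j | ψ (f j) ≠ ψ (f i)}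
          ≤ (if ψ ∈ A then ρ else 0) + ρ ^ D := by
        intro ψ hψ
        by_cases hψA : ψ ∈ A
        · have hpos : #{j | ψ (f j) ≠ ψ (f i)} ≠ 0 := by
            obtain ⟨j, k, hjk⟩ := hf ψ (ne_of_mem_erase hψ)
            refine card_ne_zero.mpr ?_
            by_cases hj : ψ (f j) = ψ (f i)
            · exact ⟨k, by simpa using fun hk => hjk (hj.trans hk.symm)⟩
            · exact ⟨j, by simpa using hj⟩
          rw [if_pos hψA]
          have := pow_le_of_le_one hρ.le hρ1.le hpos
          have := Real.rpow_pos_of_pos hρ D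
          linarith
        · rw [if_neg hψA, zero_add, ← Real.rpow_natCast]
          exact Real.rpow_le_rpow_of_exponent_ge hρ hρ1.le (hfar ψ hψA _).le
      have h2 := sum_le_sum h1
      rw [sum_add_distrib, sum_const, nsmul_eq_mul] at h2
      have h3 : ∑ ψ ∈ univ.erase (0 : AddChar G ℂ), (if ψ ∈ A then ρ else 0)
          = (#A - 1) * ρ := by
        rw [← sum_filter, sum_const, nsmul_eq_mul]
        congr 1
        rw [eq_sub_iff_add_eq]
        have : (univ.erase (0 : AddChar G ℂ)).filter (· ∈ A) = A.erase 0 := by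
          ext ψ; simp
        rw [this]
        exact_mod_cast card_erase_add_one h0
      have h4 : (#(univ.erase (0 : AddChar G ℂ)) : ℝ) * ρ ^ D ≤ (1 - ρ) / 4 := by
        refine le_trans (mul_le_mul_of_nonneg_right ?_ (Real.rpow_nonneg hρ.le D)) hD
        rw [← AddChar.card_eq (α := G)]
        exact_mod_cast card_le_univ _
      have h5 : (2 : ℝ) ≤ #A := by exact_mod_cast hA
      rw [h3] at h2
      -- The inequality 1 + (#A - 1)ρ + (1 - ρ)/4 ≤ #A(1 - (1 - ρ)/4) amounts to 3 #A ≥ 5.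
      nlinarith
    · have h1 : ∑ ψ ∈ univ.erase (0 : AddChar G ℂ), ρ ^ #{j | ψ (f j) ≠ ψ (f i)}
          ≤ ∑ ψ ∈ univ.erase (0 : AddChar G ℂ), 1 :=
        sum_le_sum fun ψ _ => pow_le_one₀ hρ.le hρ1.le
      have h2 : (#(univ.erase (0 : AddChar G ℂ)) : ℝ) + 1 = Fintype.card G := by
        rw [← AddChar.card_eq (α := G), ← card_univ]
        exact_mod_cast card_erase_add_one (mem_univ _)
      rw [sum_const, nsmul_eq_mul, mul_one] at h1
      rw [div_mul_cancel₀ _ (by positivity)]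
      linarith
  refine (prod_le_prod (fun i _ => hq0 i) fun i _ => hle i).trans ?_
  rw [prod_mul_distrib, mul_comm, prod_ite, prod_const_one, one_mul, prod_const,
    ← Real.rpow_natCast]
  refine mul_le_mul_of_nonneg_right (Real.rpow_le_rpow_of_exponent_le ht hg) ?_
  exact prod_nonneg fun i _ => fibreWeight_nonneg (by linarith) (by linarith) _ _ _

-- Lets the subtracted main term 1 be absorbed by the same weights: in the fibre, #A(1 - (1 - ρ)/4)
-- ≥ 2 · 3/4.
open Classical in
theorem one_le_prod_fibreWeight {n : ℕ} {ρ t E : ℝ} (hρ : 0 < ρ) (ht : 1 ≤ t) (hρ1 : ρ < 1)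
    {f : Fin n → G} {A : Finset (AddChar G ℂ)} (hA : 2 ≤ #A) {g : G}
    (hg : (#{j | ¬ ∀ ψ ∈ A, ψ (f j) = ψ g} : ℝ) ≤ E) :
    1 ≤ t ^ E * ∏ j, fibreWeight ((1 - ρ) / 4) t A g (f j) := by
  have hle : ∀ i, 1 ≤ fibreWeight ((1 - ρ) / 4) t A g (f i)
      * (if ∀ ψ ∈ A, ψ (f i) = ψ g then 1 else t) := by
    intro i
    unfold fibreWeight
    split_ifs with hi
    · have h5 : (2 : ℝ) ≤ #A := by exact_mod_cast hA
      nlinarith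
    · rw [div_mul_cancel₀ _ (by positivity)]
      exact_mod_cast Fintype.card_pos
  have h1 : (1 : ℝ) ≤ ∏ i, (fibreWeight ((1 - ρ) / 4) t A g (f i)
      * (if ∀ ψ ∈ A, ψ (f i) = ψ g then 1 else t)) := by
    have := prod_le_prod (s := univ) (f := fun _ : Fin n => (1 : ℝ)) (fun i _ => zero_le_one)
      fun i _ => hle i
    simpa using this
  refine h1.trans ?_
  rw [prod_mul_distrib, mul_comm, prod_ite, prod_const_one, one_mul, prod_const,
    ← Real.rpow_natCast]
  refine mul_le_mul_of_nonneg_right (Real.rpow_le_rpow_of_exponent_le ht hg) ?_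
  exact prod_nonneg fun i _ => fibreWeight_nonneg (by linarith) (by linarith) _ _ _

open Classical in
/-- The characters that are constant along `f` up to at most `D` exceptions. -/
noncomputable def nearlyConstantChars {n : ℕ} (D : ℝ) (f : Fin n → G) : Finset (AddChar G ℂ) :=
  {ψ | ∃ v, (#{j | ψ (f j) ≠ v} : ℝ) ≤ D}

-- Each character in the set has at most D exceptions to its majority value, so fewer than n indices
-- are exceptional for any of them. A remaining index j gives g = f j.
open Classical in
theorem exists_fibre_of_nearlyConstantChars {n : ℕ} {D : ℝ} (hD0 : 0 ≤ D)
    (hD : Fintype.card G * D < n) (f : Fin n → G) :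
    ∃ g, (#{j | ¬ ∀ ψ ∈ nearlyConstantChars D f, ψ (f j) = ψ g} : ℝ) ≤ Fintype.card G * D := by
  have : ∀ ψ ∈ nearlyConstantChars D f, ∃ v, (#{j | ψ (f j) ≠ v} : ℝ) ≤ D := by
    intro ψ hψ
    simpa [nearlyConstantChars] using hψ
  choose! v hv using this
  have h1 : (#{j | ¬ ∀ ψ ∈ nearlyConstantChars D f, ψ (f j) = v ψ} : ℝ)
      ≤ Fintype.card G * D := by
    have hsub : ({j | ¬ ∀ ψ ∈ nearlyConstantChars D f, ψ (f j) = v ψ} : Finset (Fin n))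
        ⊆ (nearlyConstantChars D f).biUnion fun ψ => {j | ψ (f j) ≠ v ψ} := by
      intro j hj
      simpa using hj
    calc (#{j | ¬ ∀ ψ ∈ nearlyConstantChars D f, ψ (f j) = v ψ} : ℝ)
        ≤ #((nearlyConstantChars D f).biUnion fun ψ => {j | ψ (f j) ≠ v ψ}) := by
          exact_mod_cast card_le_card hsub
      _ ≤ ∑ ψ ∈ nearlyConstantChars D f, (#{j | ψ (f j) ≠ v ψ} : ℝ) := by
          exact_mod_cast card_biUnion_le
      _ ≤ ∑ ψ ∈ nearlyConstantChars D f, D := sum_le_sum fun ψ hψ => hv ψ hψ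
      _ ≤ Fintype.card G * D := by
          rw [sum_const, nsmul_eq_mul, ← AddChar.card_eq (α := G)]
          exact mul_le_mul_of_nonneg_right (by exact_mod_cast card_le_univ _) hD0
  obtain ⟨j, hj⟩ : ∃ j, ∀ ψ ∈ nearlyConstantChars D f, ψ (f j) = v ψ := by
    by_contra! hcon
    rw [filter_true_of_mem (fun j _ => by simpa using hcon j), card_univ,
      Fintype.card_fin] at h1
    linarith
  refine ⟨f j, le_trans (le_of_eq ?_) h1⟩
  congr 2
  ext k
  simp only [mem_filter, mem_univ, true_and]
  exact not_congr (forall₂_congr fun ψ hψ => by rw [hj ψ hψ])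

end Combinatorics

/-! ### Averaging the row products over all vectors. -/

section Combinatorics

open Finset

variable {G : Type*} [AddCommGroup G] [Fintype G]

open Classical in
/-- The contribution of a single vector is close to one, up to an error measured by the fibre
weights. -/
theorem norm_ite_prod_sub_one_le {n : ℕ} {ρ t D : ℝ} (hρ : 0 < ρ) (hρ1 : ρ < 1) (ht : 1 ≤ t)
    (hD0 : 0 ≤ D) (hDn : Fintype.card G * D < n)
    (hD : Fintype.card G * ρ ^ D ≤ (1 - ρ) / 4) (f : Fin n → G) {q : Fin n → ℂ}
    (hq : ∀ i, ‖q i - 1‖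
      ≤ ∑ ψ ∈ univ.erase (0 : AddChar G ℂ), ρ ^ #{j | ψ (f j) ≠ ψ (f i)}) :
    ‖(if IsSpread f then ∏ i, q i else 0) - 1‖
      ≤ (Real.exp (n * (Fintype.card G * ρ ^ D)) - 1) +
        2 * (t ^ (Fintype.card G * D) * ∑ A : Finset (AddChar G ℂ), ∑ g : G,
          ∏ j, fibreWeight ((1 - ρ) / 4) t A g (f j)) := by
  have hw : ∀ A g x, 0 ≤ fibreWeight (G := G) ((1 - ρ) / 4) t A g x :=
    fibreWeight_nonneg (by linarith) (by linarith)
  have h0 : (0 : AddChar G ℂ) ∈ nearlyConstantChars D f := by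
    simp only [nearlyConstantChars, mem_filter, mem_univ, true_and]
    exact ⟨1, by simpa using hD0⟩
  have hexp0 : 0 ≤ Real.exp (n * (Fintype.card G * ρ ^ D)) - 1 := by
    rw [sub_nonneg, Real.one_le_exp_iff]
    positivity
  have hfar : ∀ ψ ∉ nearlyConstantChars D f, ∀ v, D < #{j | ψ (f j) ≠ v} := by
    intro ψ hψ v
    by_contra! h
    exact hψ (by simp only [nearlyConstantChars, mem_filter, mem_univ, true_and]; exact ⟨v, h⟩)
  by_cases hA : 2 ≤ #(nearlyConstantChars D f)
  · obtain ⟨g, hg⟩ := exists_fibre_of_nearlyConstantChars hD0 hDn f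
    have hterm : t ^ (Fintype.card G * D) *
          ∏ j, fibreWeight ((1 - ρ) / 4) t (nearlyConstantChars D f) g (f j)
        ≤ t ^ (Fintype.card G * D) * ∑ A : Finset (AddChar G ℂ), ∑ g : G,
          ∏ j, fibreWeight ((1 - ρ) / 4) t A g (f j) := by
      refine mul_le_mul_of_nonneg_left ?_ (by positivity)
      refine le_trans ?_ (single_le_sum (f := fun A : Finset (AddChar G ℂ) =>
        ∑ g : G, ∏ j, fibreWeight ((1 - ρ) / 4) t A g (f j))
        (fun A _ => sum_nonneg fun g _ => prod_nonneg fun j _ => hw A g _)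
        (mem_univ (nearlyConstantChars D f)))
      exact single_le_sum (f := fun g : G =>
        ∏ j, fibreWeight ((1 - ρ) / 4) t (nearlyConstantChars D f) g (f j))
        (fun g _ => prod_nonneg fun j _ => hw _ g _) (mem_univ g)
    have h1 := one_le_prod_fibreWeight hρ ht hρ1 hA hg
    have h2 : ‖if IsSpread f then ∏ i, q i else 0‖ ≤ t ^ (Fintype.card G * D) *
          ∏ j, fibreWeight ((1 - ρ) / 4) t (nearlyConstantChars D f) g (f j) := by
      split_ifs with hf
      · rw [norm_prod]
        refine prod_le_prod_fibreWeight hρ hρ1 ht hf h0 hA hfar hg hD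
          (fun i => norm_nonneg _) fun i => ?_
        have := norm_sub_norm_le (q i) 1
        rw [norm_one] at this
        linarith [hq i]
      · rw [norm_zero]
        linarith
    have h3 := norm_sub_le (if IsSpread f then ∏ i, q i else 0) (1 : ℂ)
    rw [norm_one] at h3
    -- The product and the 1 are each at most the weight term, hence the factor 2.
    linarith
  · have hA1 : nearlyConstantChars D f = {0} := by
      have : #(nearlyConstantChars D f) ≤ 1 := by omega
      exact (card_le_one_iff_subset_singleton.mp this).elim fun x hx => by
        have hx0 : (0 : AddChar G ℂ) = x := by simpa using hx h0
        subst hx0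
        exact subset_antisymm hx (by simpa using h0)
    have hfar' : ∀ ψ ∈ univ.erase (0 : AddChar G ℂ), ∀ v, D < #{j | ψ (f j) ≠ v} := by
      intro ψ hψ
      exact hfar ψ (by rw [hA1]; simpa using hψ)
    -- A nontrivial character constant along f would have no exceptions and be nearly constant.
    have hf : IsSpread f := by
      intro ψ hψ
      by_contra! hcon
      have hn : 0 < n := by
        have : (0 : ℝ) < n := lt_of_le_of_lt (by positivity) hDn
        exact_mod_cast this
      have := hfar' ψ (by simpa using hψ) (ψ (f ⟨0, hn⟩))
      rw [filter_false_of_mem (fun j _ => by simpa using hcon j ⟨0, hn⟩)] at this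
      simp only [card_empty, Nat.cast_zero] at this
      linarith
    rw [if_pos hf]
    have hq1 : ∀ i, ‖q i - 1‖ ≤ Fintype.card G * ρ ^ D := by
      intro i
      refine (hq i).trans ?_
      calc ∑ ψ ∈ univ.erase (0 : AddChar G ℂ), ρ ^ #{j | ψ (f j) ≠ ψ (f i)}
          ≤ ∑ ψ ∈ univ.erase (0 : AddChar G ℂ), ρ ^ D := by
            refine sum_le_sum fun ψ hψ => ?_
            rw [← Real.rpow_natCast]
            exact Real.rpow_le_rpow_of_exponent_ge hρ hρ1.le (hfar' ψ hψ _).le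
        _ ≤ Fintype.card G * ρ ^ D := by
            rw [sum_const, nsmul_eq_mul, ← AddChar.card_eq (α := G)]
            exact mul_le_mul_of_nonneg_right (by exact_mod_cast card_le_univ _)
              (Real.rpow_nonneg hρ.le D)
    have h1 := norm_prod_one_add_sub_one_le univ fun i => q i - 1
    simp only [add_sub_cancel] at h1
    have h2 : ∑ i, ‖q i - 1‖ ≤ n * (Fintype.card G * ρ ^ D) := by
      have := sum_le_sum fun i (_ : i ∈ (univ : Finset (Fin n))) => hq1 i
      simpa using this
    have h3 : 0 ≤ t ^ (Fintype.card G * D) * ∑ A : Finset (AddChar G ℂ), ∑ g : G,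
          ∏ j, fibreWeight ((1 - ρ) / 4) t A g (f j) :=
      mul_nonneg (by positivity)
        (sum_nonneg fun A _ => sum_nonneg fun g _ => prod_nonneg fun j _ => hw A g _)
    linarith [Real.exp_le_exp.mpr h2]

-- The 1 moves inside the average over all |G|^n vectors. There are 2^|G| sets A and |G| base points
-- g, and the |G|^n in the weight sum cancels the normalisation.
open Classical in
theorem norm_average_sub_one_le {n : ℕ} {ρ t D : ℝ} (hρ : 0 < ρ) (hρ1 : ρ < 1) (ht : 1 ≤ t)
    (hD0 : 0 ≤ D) (hDn : Fintype.card G * D < n)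
    (hD : Fintype.card G * ρ ^ D ≤ (1 - ρ) / 4) {q : (Fin n → G) → Fin n → ℂ}
    (hq : ∀ f i, ‖q f i - 1‖
      ≤ ∑ ψ ∈ univ.erase (0 : AddChar G ℂ), ρ ^ #{j | ψ (f j) ≠ ψ (f i)}) :
    ‖((Fintype.card G : ℂ) ^ n)⁻¹ * ∑ f with IsSpread f, ∏ i, q f i - 1‖
      ≤ (Real.exp (n * (Fintype.card G * ρ ^ D)) - 1) +
        2 * (t ^ (Fintype.card G * D) * (2 ^ Fintype.card G * Fintype.card G *
          (1 - (1 - ρ) / 4 + Fintype.card G / t) ^ n)) := by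
  have hN : (0 : ℝ) < Fintype.card G := by exact_mod_cast Fintype.card_pos
  have hNC : (Fintype.card G : ℂ) ^ n ≠ 0 := by simp
  have hcard : Fintype.card (Fin n → G) = Fintype.card G ^ n := by simp
  have h1 : ((Fintype.card G : ℂ) ^ n)⁻¹ * ∑ f with IsSpread f, ∏ i, q f i - 1
      = ((Fintype.card G : ℂ) ^ n)⁻¹ *
        ∑ f : Fin n → G, ((if IsSpread f then ∏ i, q f i else 0) - 1) := by
    rw [sum_sub_distrib, ← sum_filter, mul_sub, sum_const, card_univ, hcard, nsmul_eq_mul, mul_one,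
      Nat.cast_pow, inv_mul_cancel₀ hNC]
  rw [h1, norm_mul, norm_inv, norm_pow, Complex.norm_natCast, inv_mul_le_iff₀ (by positivity)]
  refine (norm_sum_le _ _).trans ((sum_le_sum fun f _ =>
    norm_ite_prod_sub_one_le hρ hρ1 ht hD0 hDn hD f (hq f)).trans ?_)
  rw [sum_add_distrib, sum_const, card_univ, hcard, nsmul_eq_mul, Nat.cast_pow, mul_add,
    ← mul_sum, ← mul_sum]
  refine add_le_add le_rfl ?_
  have h2 : ∑ f : Fin n → G, ∑ A : Finset (AddChar G ℂ), ∑ g : G,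
        ∏ j, fibreWeight ((1 - ρ) / 4) t A g (f j)
      ≤ 2 ^ Fintype.card G * (Fintype.card G *
        (Fintype.card G * (1 - (1 - ρ) / 4 + Fintype.card G / t)) ^ n) := by
    rw [sum_comm]
    simp_rw [fun A : Finset (AddChar G ℂ) => sum_comm (s := (univ : Finset (Fin n → G)))
      (t := (univ : Finset G))
      (f := fun f g => ∏ j, fibreWeight ((1 - ρ) / 4) t A g (f j))]
    refine (sum_le_sum fun A _ => sum_le_sum fun g _ =>
      sum_prod_fibreWeight_le (by linarith) (by linarith) A g n).trans (le_of_eq ?_)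
    simp only [sum_const, card_univ, Fintype.card_finset, AddChar.card_eq, nsmul_eq_mul,
      Nat.cast_pow, Nat.cast_ofNat]
  calc 2 * (t ^ (Fintype.card G * D) * ∑ f : Fin n → G, ∑ A : Finset (AddChar G ℂ), ∑ g : G,
        ∏ j, fibreWeight ((1 - ρ) / 4) t A g (f j))
      ≤ 2 * (t ^ (Fintype.card G * D) * (2 ^ Fintype.card G * (Fintype.card G *
        (Fintype.card G * (1 - (1 - ρ) / 4 + Fintype.card G / t)) ^ n))) := by gcongr
    _ = _ := by rw [mul_pow]; ring

open Filter Topology in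
open Classical in
/-- The average over all spread vectors of products of row factors tends to one exponentially
fast, uniformly in the row factors. -/
theorem exists_norm_average_sub_one_le (G : Type*) [AddCommGroup G] [Fintype G] {ρ : ℝ}
    (hρ : 0 < ρ) (hρ1 : ρ < 1) :
    ∃ K c : ℝ, ∃ n₀ : ℕ, 0 < K ∧ 0 < c ∧ ∀ n ≥ n₀, ∀ q : (Fin n → G) → Fin n → ℂ,
      (∀ f i, ‖q f i - 1‖
        ≤ ∑ ψ ∈ univ.erase (0 : AddChar G ℂ), ρ ^ #{j | ψ (f j) ≠ ψ (f i)}) →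
      ‖((Fintype.card G : ℂ) ^ n)⁻¹ * ∑ f with IsSpread f, ∏ i, q f i - 1‖
        ≤ K * Real.exp (-c * n) := by
  set N : ℝ := (Fintype.card G : ℝ) with hNdef
  have hN : 1 ≤ N := by rw [hNdef]; exact_mod_cast (Fintype.card_pos : 0 < Fintype.card G)
  set κ : ℝ := (1 - ρ) / 4 with hκdef
  have hκ : 0 < κ := by rw [hκdef]; linarith
  have hκ1 : κ ≤ 1 / 4 := by rw [hκdef]; linarith
  -- Chosen so that N/t = κ/2, leaving half of the gain κ.
  set t : ℝ := 2 * N / κ with htdef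
  have ht : 1 ≤ t := by rw [htdef, le_div_iff₀ hκ]; linarith
  have hNt : 1 - κ + N / t = 1 - κ / 2 := by rw [htdef]; field_simp; ring
  -- As t^η → 1 when η → 0, the repayment t^(ηn) loses to (1 - κ/2)^n for small η.
  obtain ⟨η, hη0, hη1, hηt⟩ : ∃ η : ℝ, 0 < η ∧ η < 1 ∧ t ^ η * (1 - κ / 2) < 1 := by
    have hlim : Tendsto (fun η : ℝ => t ^ η * (1 - κ / 2)) (𝓝[>] 0) (𝓝 (t ^ (0 : ℝ) * (1 - κ / 2))) :=
      ((Real.continuous_const_rpow (by positivity)).mul continuous_const).continuousAt.tendsto.mono_left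
        nhdsWithin_le_nhds
    have h1 : ∀ᶠ η : ℝ in 𝓝[>] 0, t ^ η * (1 - κ / 2) < 1 :=
      hlim.eventually_lt_const (by rw [Real.rpow_zero]; linarith)
    have h2 : ∀ᶠ η : ℝ in 𝓝[>] 0, η ∈ Set.Ioo (0 : ℝ) 1 := Ioo_mem_nhdsGT one_pos
    obtain ⟨η, h3, h4⟩ := (h1.and h2).exists
    exact ⟨η, h4.1, h4.2, h3⟩
  -- With D = δn this makes |G|D = ηn, which is below n.
  set δ : ℝ := η / N with hδdef
  have hδ : 0 < δ := by positivity
  -- The exponent is halved so that ρ^D = r^n · r^n: one factor absorbs n|G|, the other is the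
  -- decay.
  set r : ℝ := ρ ^ (δ / 2) with hrdef
  have hr0 : 0 < r := Real.rpow_pos_of_pos hρ _
  have hr1 : r < 1 := Real.rpow_lt_one hρ.le hρ1 (by positivity)
  have hpow : ∀ n : ℕ, ρ ^ (δ * n) = r ^ n * r ^ n := by
    intro n
    rw [hrdef, ← Real.rpow_natCast, ← Real.rpow_mul hρ.le, ← Real.rpow_add hρ]
    congr 1
    ring
  set s : ℝ := t ^ η * (1 - κ / 2) with hsdef
  have hs0 : 0 < s := mul_pos (by positivity) (by linarith)
  have hlim1 : Tendsto (fun n : ℕ => N * ((n : ℝ) * r ^ n)) atTop (𝓝 0) := by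
    have := (tendsto_pow_const_mul_const_pow_of_abs_lt_one 1
      (r := r) (by rwa [abs_of_pos hr0])).const_mul N
    simpa using this
  have hlim2 : Tendsto (fun n : ℕ => N * (r ^ n * r ^ n)) atTop (𝓝 0) := by
    have := (tendsto_pow_atTop_nhds_zero_of_lt_one hr0.le hr1)
    simpa using (this.mul this).const_mul N
  obtain ⟨n₀, hn₀⟩ := eventually_atTop.mp ((hlim1.eventually_lt_const one_pos).and
    ((hlim2.eventually_lt_const hκ).and (eventually_ge_atTop 1)))
  set m : ℝ := max r s with hm
  have hm0 : 0 < m := lt_max_of_lt_left hr0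
  have hm1 : m < 1 := max_lt hr1 hηt
  refine ⟨2 + 2 * (2 ^ Fintype.card G * N), -Real.log m, n₀, by positivity,
    by linarith [Real.log_neg hm0 hm1], fun n hn q hq => ?_⟩
  obtain ⟨h1, h2, h3⟩ := hn₀ n hn
  have hn1 : (1 : ℝ) ≤ n := by exact_mod_cast h3
  have hND : N * (δ * n) = η * n := by rw [hδdef]; field_simp
  have hmain := norm_average_sub_one_le hρ hρ1 ht (D := δ * n) (by positivity)
    (by rw [← hNdef, hND]; nlinarith) (by rw [← hNdef, hpow]; exact h2.le) hq
  rw [← hNdef, ← hκdef, hND, hNt, hpow] at hmain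
  refine hmain.trans ?_
  have hexp : Real.exp (-(-Real.log m) * n) = m ^ n := by
    rw [neg_neg, mul_comm, Real.exp_nat_mul, Real.exp_log hm0]
  rw [hexp]
  have hrm : r ^ n ≤ m ^ n := pow_le_pow_left₀ hr0.le (le_max_left _ _) n
  have hsm : s ^ n ≤ m ^ n := pow_le_pow_left₀ hs0.le (le_max_right _ _) n
  have hrn : 0 < r ^ n := pow_pos hr0 n
  have hrn1 : r ^ n ≤ 1 := pow_le_one₀ hr0.le hr1.le
  have hx : n * (N * (r ^ n * r ^ n)) ≤ r ^ n := by
    have : n * (N * (r ^ n * r ^ n)) = (N * (n * r ^ n)) * r ^ n := by ring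
    rw [this]
    nlinarith
  have hx0 : 0 ≤ n * (N * (r ^ n * r ^ n)) := by positivity
  have h4 : Real.exp (n * (N * (r ^ n * r ^ n))) - 1 ≤ 2 * r ^ n := by
    have := Real.abs_exp_sub_one_le (x := n * (N * (r ^ n * r ^ n)))
      (by rw [abs_of_nonneg hx0]; linarith)
    rw [abs_of_nonneg hx0] at this
    linarith [le_abs_self (Real.exp (n * (N * (r ^ n * r ^ n))) - 1)]
  have h5 : t ^ (η * n) * (2 ^ Fintype.card G * N * (1 - κ / 2) ^ n)
      = 2 ^ Fintype.card G * N * s ^ n := by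
    rw [Real.rpow_mul (by positivity), Real.rpow_natCast, hsdef, mul_pow]
    ring
  rw [h5]
  have h6 : 2 ^ Fintype.card G * N * s ^ n ≤ 2 ^ Fintype.card G * N * m ^ n := by gcongr
  linarith

end Combinatorics

/-! ### Surjections from the sandpile group as spread vectors. -/

namespace MultiDigraph

variable {V : Type*} [Fintype V] [DecidableEq V]

/-- The difference of two standard basis vectors. -/
def singleSub (i j : V) : sumZero V :=
  ⟨Pi.single i 1 - Pi.single j 1, by
    change ∑ k, (Pi.single i (1 : ℤ) - Pi.single j 1 : V → ℤ) k = 0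
    simp [Finset.sum_sub_distrib]⟩

theorem eq_sum_smul_singleSub (x : sumZero V) (j₀ : V) :
    x = ∑ j, (x : V → ℤ) j • singleSub j j₀ := by
  ext k
  have hx : ∑ j, (x : V → ℤ) j = 0 := x.2
  have h : ((∑ j, (x : V → ℤ) j • singleSub j j₀ : sumZero V) : V → ℤ) k
      = ∑ j, (x : V → ℤ) j * ((Pi.single j (1 : ℤ) : V → ℤ) k - (Pi.single j₀ 1 : V → ℤ) k) := by
    simp [singleSub]
  rw [h]
  simp_rw [mul_sub]
  rw [Finset.sum_sub_distrib, ← Finset.sum_mul, hx]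
  simp [Pi.single_apply]

variable {G : Type*} [AddCommGroup G]

/-- Loops drop out of both sides: they cancel in the Laplacian and multiply f i - f i. -/
theorem sum_laplacian_smul (Γ : MultiDigraph V) (f : V → G) (i : V) :
    ∑ j, Γ.laplacian i j • f j = ∑ j, Γ.deg i j • (f i - f j) := by
  have h : ∀ j, Γ.laplacian i j = (if i = j then (Γ.outdeg i : ℤ) else 0) - Γ.deg i j := by
    intro j
    by_cases hij : i = j
    · subst hij; simp [laplacian]
    · simp [laplacian, hij]
  simp_rw [h, sub_smul, smul_sub]
  rw [Finset.sum_sub_distrib, Finset.sum_sub_distrib, ← Finset.sum_smul]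
  simp [ite_smul, outdeg, Finset.sum_smul]

/-- The homomorphism from sum-zero vectors given by pairing with `f`. -/
def pairing (f : V → G) : sumZero V →+ G where
  toFun x := ∑ j, (x : V → ℤ) j • f j
  map_zero' := by simp
  map_add' x y := by simp [add_smul, Finset.sum_add_distrib]

theorem pairing_singleSub (f : V → G) (i j : V) : pairing f (singleSub i j) = f i - f j := by
  simp [pairing, singleSub, sub_smul, Finset.sum_sub_distrib, Pi.single_apply, ite_smul]

theorem pairing_eq_zero_of_mem (Γ : MultiDigraph V) {f : V → G}
    (hf : ∀ i, ∑ j, Γ.deg i j • (f i - f j) = 0)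
    {x : sumZero V} (hx : (x : V → ℤ) ∈ Γ.laplacianImage) : pairing f x = 0 := by
  obtain ⟨v, hv⟩ := hx
  have h : ∀ j, (x : V → ℤ) j = ∑ i, v i * Γ.laplacian i j := by
    intro j
    rw [← hv]
    rfl
  change ∑ j, (x : V → ℤ) j • f j = 0
  simp_rw [h, Finset.sum_smul, mul_smul]
  rw [Finset.sum_comm]
  refine Finset.sum_eq_zero fun i _ => ?_
  rw [← Finset.smul_sum, sum_laplacian_smul, hf, smul_zero]

/-- The projection onto the total sandpile group. -/
def toSandpile (Γ : MultiDigraph V) : sumZero V →+ Γ.TotalSandpile :=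
  (Submodule.mkQ (Γ.laplacianImage.submoduleOf (sumZero V))).toAddMonoidHom

theorem toSandpile_surjective (Γ : MultiDigraph V) : Function.Surjective Γ.toSandpile :=
  Submodule.mkQ_surjective _

theorem toSandpile_eq_zero_of_mem (Γ : MultiDigraph V) {x : sumZero V}
    (hx : (x : V → ℤ) ∈ Γ.laplacianImage) : Γ.toSandpile x = 0 :=
  (Submodule.Quotient.mk_eq_zero _).mpr (show _ ∈ _ from hx)

theorem hom_ext_singleSub {Γ : MultiDigraph V} (j₀ : V) {φ χ : Γ.TotalSandpile →+ G}
    (h : ∀ j, φ (Γ.toSandpile (singleSub j j₀)) = χ (Γ.toSandpile (singleSub j j₀))) : φ = χ := by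
  ext s
  obtain ⟨x, rfl⟩ := Γ.toSandpile_surjective s
  rw [eq_sum_smul_singleSub x j₀]
  simp only [map_sum, map_zsmul, h]

/-- The values of a homomorphism on basis differences satisfy the row relations. -/
theorem sum_deg_smul_hom_sub (Γ : MultiDigraph V) (j₀ : V) (φ : Γ.TotalSandpile →+ G) (i : V) :
    ∑ j, Γ.deg i j • (φ (Γ.toSandpile (singleSub i j₀)) - φ (Γ.toSandpile (singleSub j j₀))) = 0 := by
  have hmem : (Γ.laplacian i : V → ℤ) ∈ Γ.laplacianImage :=
    ⟨Pi.single i 1, by simp [Matrix.row]⟩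
  set x : sumZero V := ⟨Γ.laplacian i, Γ.laplacianImage_le_sumZero hmem⟩ with hx
  have h0 : φ (Γ.toSandpile x) = 0 := by rw [Γ.toSandpile_eq_zero_of_mem hmem, map_zero]
  rw [eq_sum_smul_singleSub x j₀] at h0
  simp only [map_sum, map_zsmul] at h0
  rw [← h0, ← sum_laplacian_smul Γ (fun j => φ (Γ.toSandpile (singleSub j j₀)))]

/-- The entry at j₀ is g, so a character constant along the vector is trivial on the images of the
generators, hence on all of `G`. -/
theorem isSpread_of_surjective {Γ : MultiDigraph V} (j₀ : V) {φ : Γ.TotalSandpile →+ G}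
    (hφ : Function.Surjective φ) (g : G) :
    IsSpread fun j => φ (Γ.toSandpile (singleSub j j₀)) + g := by
  intro ψ hψ
  by_contra! hcon
  have h1 : ∀ j, ψ (φ (Γ.toSandpile (singleSub j j₀))) = 1 := by
    intro j
    have h2 := hcon j j₀
    have h3 : singleSub j₀ j₀ = 0 := by ext; simp [singleSub]
    have h4 := congrArg (· * ψ (-g)) h2
    simp only [h3, ← ψ.map_add_eq_mul, add_neg_cancel_right] at h4
    simpa using h4
  refine hψ (DFunLike.ext _ _ fun y => ?_)
  obtain ⟨s, rfl⟩ := hφ y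
  obtain ⟨x, rfl⟩ := Γ.toSandpile_surjective s
  rw [eq_sum_smul_singleSub x j₀]
  simp only [map_sum, map_zsmul]
  rw [ψ.map_sum_eq_prod]
  refine Finset.prod_eq_one fun j _ => ?_
  rw [ψ.map_zsmul_eq_zpow, h1, one_zpow]

/-- If the range were proper, a nontrivial character of the quotient by it would pull back to one
constant along f, since the differences of f lie in the range. -/
theorem surjective_of_isSpread [Finite G] {f : V → G} (hf : IsSpread f) (φ : sumZero V →+ G)
    (hφ : ∀ i j, φ (singleSub i j) = f i - f j) : Function.Surjective φ := by
  rw [← AddMonoidHom.range_eq_top]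
  by_contra hne
  obtain ⟨y, hy⟩ : ∃ y, y ∉ φ.range := by
    by_contra! h
    exact hne (AddSubgroup.eq_top_iff' _ |>.mpr h)
  obtain ⟨χ, hχ⟩ := AddChar.exists_apply_ne_zero (a := (QuotientAddGroup.mk y : G ⧸ φ.range)).mpr
    (by rwa [Ne, QuotientAddGroup.eq_zero_iff])
  obtain ⟨j, k, hjk⟩ := hf (χ.compAddMonoidHom (QuotientAddGroup.mk' φ.range))
    (AddChar.ne_zero_iff.mpr ⟨y, hχ⟩)
  refine hjk ?_
  have : (QuotientAddGroup.mk' φ.range) (f j) = (QuotientAddGroup.mk' φ.range) (f k) := by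
    rw [← sub_eq_zero, ← map_sub, ← hφ]
    exact (QuotientAddGroup.eq_zero_iff _).mpr ⟨_, rfl⟩
  rw [AddChar.compAddMonoidHom_apply, AddChar.compAddMonoidHom_apply, this]

/-- Surjections from the total sandpile group, together with a base value, correspond to spread
vectors annihilated by the laplacian. -/
theorem numSur_mul_card [Finite G] (Γ : MultiDigraph V) (j₀ : V) :
    numSur Γ.TotalSandpile G * Nat.card G
      = Nat.card {f : V → G // IsSpread f ∧ ∀ i, ∑ j, Γ.deg i j • (f i - f j) = 0} := by
  rw [numSur, ← Nat.card_prod]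
  let F : {φ : Γ.TotalSandpile →+ G // Function.Surjective φ} × G →
      {f : V → G // IsSpread f ∧ ∀ i, ∑ j, Γ.deg i j • (f i - f j) = 0} := fun q =>
    ⟨fun j => q.1.1 (Γ.toSandpile (singleSub j j₀)) + q.2, isSpread_of_surjective j₀ q.1.2 q.2,
      fun i => by
        simp only [add_sub_add_right_eq_sub]
        exact sum_deg_smul_hom_sub Γ j₀ q.1.1 i⟩
  have h3 : singleSub j₀ j₀ = 0 := by ext; simp [singleSub]
  refine Nat.card_congr (Equiv.ofBijective F ⟨?_, ?_⟩)
  · rintro ⟨⟨φ, hφ⟩, g⟩ ⟨⟨χ, hχ⟩, g'⟩ h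
    have h1 : ∀ j, φ (Γ.toSandpile (singleSub j j₀)) + g
        = χ (Γ.toSandpile (singleSub j j₀)) + g' :=
      fun j => congrFun (congrArg Subtype.val h) j
    have h2 : g = g' := by simpa [h3] using h1 j₀
    subst h2
    have h4 : φ = χ := hom_ext_singleSub j₀ fun j => by simpa using h1 j
    subst h4
    rfl
  · rintro ⟨f, hf, hrow⟩
    let φ : Γ.TotalSandpile →+ G := QuotientAddGroup.lift _ (pairing f)
      fun x hx => pairing_eq_zero_of_mem Γ hrow hx
    have hφ : ∀ x, φ (Γ.toSandpile x) = pairing f x := fun x => rfl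
    have hsurj : Function.Surjective φ := by
      intro y
      obtain ⟨x, hx⟩ := surjective_of_isSpread hf (pairing f) (pairing_singleSub f) y
      exact ⟨Γ.toSandpile x, hx⟩
    refine ⟨⟨⟨φ, hsurj⟩, f j₀⟩, Subtype.ext (funext fun j => ?_)⟩
    change φ (Γ.toSandpile (singleSub j j₀)) + f j₀ = f j
    rw [hφ, pairing_singleSub, sub_add_cancel]

end MultiDigraph

/-! ### The expected number of surjections. -/

section Expectation

variable {Ω : Type*} [MeasurableSpace Ω] {μ : Measure Ω} [IsProbabilityMeasure μ]
  {G : Type*} [AddCommGroup G] [Fintype G]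

/-- The trivial character gives exactly 1. For any other ψ, the j-th factor is at most ρ as soon as
ψ(f i - f j) ≠ 1, which forces i ≠ j. -/
theorem norm_sum_prod_integral_sub_one_le {V : Type*} [Fintype V] [DecidableEq V]
    {y : V → V → Ω → ℕ} {ρ : ℝ}
    (hρ : ∀ i j, i ≠ j → ∀ (ψ : AddChar G ℂ) (g : G), ψ g ≠ 1 → ‖∫ ω, ψ (y i j ω • g) ∂μ‖ ≤ ρ)
    (f : V → G) (i : V) [DecidableEq (AddChar G ℂ)]
    [∀ ψ : AddChar G ℂ, DecidablePred fun j => ψ (f j) ≠ ψ (f i)] :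
    ‖(∑ ψ : AddChar G ℂ, ∏ j, ∫ ω, ψ (y i j ω • (f i - f j)) ∂μ) - 1‖
      ≤ ∑ ψ ∈ Finset.univ.erase (0 : AddChar G ℂ),
          ρ ^ (Finset.univ.filter fun j => ψ (f j) ≠ ψ (f i)).card := by
  rw [← Finset.add_sum_erase _ _ (Finset.mem_univ (0 : AddChar G ℂ))]
  simp only [AddChar.zero_apply, integral_const, probReal_univ, one_smul, Finset.prod_const_one,
    add_sub_cancel_left]
  refine (norm_sum_le _ _).trans (Finset.sum_le_sum fun ψ _ => ?_)
  rw [norm_prod]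
  have h : ∀ j, ‖∫ ω, ψ (y i j ω • (f i - f j)) ∂μ‖
      ≤ if ψ (f j) ≠ ψ (f i) then ρ else 1 := by
    intro j
    split_ifs with hj
    · refine hρ i j (fun hij => hj (by rw [hij])) ψ _ fun h1 => hj ?_
      have h2 := ψ.map_add_eq_mul (f i - f j) (f j)
      rw [sub_add_cancel, h1, one_mul] at h2
      exact h2.symm
    · refine (norm_integral_le_of_norm_le_const (C := 1)
        (Filter.Eventually.of_forall fun ω => by rw [ψ.norm_apply])).trans ?_
      simp
  refine (Finset.prod_le_prod (fun j _ => norm_nonneg _) fun j _ => h j).trans (le_of_eq ?_)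
  rw [Finset.prod_ite, Finset.prod_const_one, mul_one, Finset.prod_const]

open Classical in
theorem numSur_eq_sum_indicator {Ω' : Type*} {n : ℕ} (hn : 0 < n)
    (Γ : Ω' → MultiDigraph (Fin n)) (ω : Ω') :
    (numSur (Γ ω).TotalSandpile G : ℝ) = (Fintype.card G : ℝ)⁻¹ *
      ∑ f : Fin n → G with IsSpread f,
        {ω | ∀ i, ∑ j, (Γ ω).deg i j • (f i - f j) = 0}.indicator (fun _ => (1 : ℝ)) ω := by
  have h := (Γ ω).numSur_mul_card (G := G) ⟨0, hn⟩
  rw [Nat.card_eq_fintype_card, Nat.card_eq_fintype_card, Fintype.card_subtype] at h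
  have hN : (Fintype.card G : ℝ) ≠ 0 := by simp
  rw [eq_inv_mul_iff_mul_eq₀ hN, mul_comm]
  rw [← Nat.cast_mul, h, ← Finset.filter_filter, Finset.card_filter]
  push_cast
  refine Finset.sum_congr rfl fun f _ => ?_
  simp [Set.indicator_apply]

/-- A crude bound that gives control for small n. The case n = 0 is separate because there is no
base vertex. -/
theorem numSur_le_pow {n : ℕ} (Γ : MultiDigraph (Fin n)) :
    numSur Γ.TotalSandpile G ≤ Fintype.card G ^ n := by
  classical
  rcases Nat.eq_zero_or_pos n with rfl | hn
  · have hs : Subsingleton Γ.TotalSandpile :=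
      ⟨fun s t => by
        obtain ⟨x, rfl⟩ := Γ.toSandpile_surjective s
        obtain ⟨z, rfl⟩ := Γ.toSandpile_surjective t
        rw [Subsingleton.elim x z]⟩
    rw [pow_zero, numSur]
    have : Subsingleton (Γ.TotalSandpile →+ G) :=
      ⟨fun φ χ => by
        ext s
        rw [Subsingleton.elim s 0, map_zero, map_zero]⟩
    exact Finite.card_le_one_iff_subsingleton.mpr inferInstance
  · have h := Γ.numSur_mul_card (G := G) ⟨0, hn⟩
    have h1 : Nat.card {f : Fin n → G // IsSpread f ∧ ∀ i, ∑ j, Γ.deg i j • (f i - f j) = 0}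
        ≤ Fintype.card G ^ n := by
      rw [Nat.card_eq_fintype_card]
      refine (Fintype.card_subtype_le _).trans (le_of_eq (by simp))
    calc numSur Γ.TotalSandpile G ≤ numSur Γ.TotalSandpile G * Nat.card G :=
          Nat.le_mul_of_pos_right _ Nat.card_pos
      _ ≤ _ := h ▸ h1

theorem integrable_numSur {n : ℕ} {Γ : Ω → MultiDigraph (Fin n)}
    (hΓ : ∀ i j, Measurable fun ω => (Γ ω).deg i j) :
    Integrable (fun ω => (numSur (Γ ω).TotalSandpile G : ℝ)) μ := by
  classical
  rcases Nat.eq_zero_or_pos n with rfl | hn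
  · have : Γ = fun _ => ⟨fun i => i.elim0⟩ := funext fun ω => by
      cases h : Γ ω
      congr 1
      exact Subsingleton.elim _ _
    subst this
    exact integrable_const _
  · simp_rw [numSur_eq_sum_indicator hn]
    refine (integrable_finsetSum _ fun f _ => ?_).const_mul _
    exact (integrable_const _).indicator (measurableSet_forall_sum_nsmul_eq_zero
      (y := fun i j ω => (Γ ω).deg i j) hΓ f)

open Classical in
theorem integral_numSur {n : ℕ} (hn : 0 < n) {Γ : Ω → MultiDigraph (Fin n)} {ε : ℝ}
    (hΓ : IsBalancedDigraph ε Γ μ) :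
    ((∫ ω, (numSur (Γ ω).TotalSandpile G : ℝ) ∂μ : ℝ) : ℂ)
      = (Fintype.card G : ℂ)⁻¹ * (((Fintype.card G : ℂ) ^ n)⁻¹ *
        ∑ f : Fin n → G with IsSpread f, ∏ i, ∑ ψ : AddChar G ℂ,
          ∏ j, ∫ ω, ψ ((Γ ω).deg i j • (f i - f j)) ∂μ) := by
  have hm : ∀ f : Fin n → G, MeasurableSet {ω | ∀ i, ∑ j, (Γ ω).deg i j • (f i - f j) = 0} :=
    measurableSet_forall_sum_nsmul_eq_zero (y := fun i j ω => (Γ ω).deg i j) hΓ.measurable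
  simp_rw [numSur_eq_sum_indicator hn]
  rw [integral_const_mul, integral_finsetSum _ fun f _ => (integrable_const _).indicator (hm f)]
  simp_rw [fun f => integral_indicator_const (μ := μ) (1 : ℝ) (hm f)]
  push_cast
  congr 1
  rw [Finset.mul_sum]
  refine Finset.sum_congr rfl fun f _ => ?_
  have h := integral_indicator_forall_sum_eq_zero (y := fun i j ω => (Γ ω).deg i j)
    hΓ.measurable hΓ.indep f
  rw [smul_eq_mul, mul_one, h, Finset.prod_mul_distrib]
  simp

end Expectation

theorem theorem3p1 (a : ℕ) (ha : 0 < a) (ε : ℝ) (hε : 0 < ε)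
    (G : Type*) [AddCommGroup G] [Finite G] (hG : AddMonoid.exponent G ∣ a) :
    ∃ K c : ℝ, 0 < K ∧ 0 < c ∧
      ∀ (n : ℕ) (Ω : Type*) [MeasurableSpace Ω] (μ : Measure Ω) [IsProbabilityMeasure μ]
        (Γ : Ω → MultiDigraph (Fin n)), IsBalancedDigraph ε Γ μ →
        Integrable (fun ω => (numSur (Γ ω).TotalSandpile G : ℝ)) μ ∧
        |(∫ ω, (numSur (Γ ω).TotalSandpile G : ℝ) ∂μ) - 1 / (Nat.card G : ℝ)|
          ≤ K * Real.exp (-c * n) := by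
  classical
  have := Fintype.ofFinite G
  obtain ⟨ρ, hρ, hρ1, hchar⟩ := exists_norm_integral_addChar_le G hε
  obtain ⟨K, c, n₀, hK, hc, hmain⟩ := exists_norm_average_sub_one_le G hρ hρ1
  have hN : (1 : ℝ) ≤ Fintype.card G := by exact_mod_cast (Fintype.card_pos : 0 < Fintype.card G)
  have hinv : (Fintype.card G : ℝ)⁻¹ ≤ 1 := inv_le_one_of_one_le₀ hN
  have hinv0 : 0 ≤ (Fintype.card G : ℝ)⁻¹ := by positivity
  -- The added term handles n ≤ n₀, where exp(c n₀) exp(-c n) ≥ 1.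
  refine ⟨K + (Fintype.card G ^ n₀ + 1) * Real.exp (c * n₀), c, by positivity, hc,
    fun n Ω _ μ _ Γ hΓ => ⟨integrable_numSur hΓ.measurable, ?_⟩⟩
  rw [Nat.card_eq_fintype_card, one_div]
  -- The threshold n₀ + 1 also guarantees n > 0, so that a base vertex exists.
  rcases le_or_gt (n₀ + 1) n with hn | hn
  · have h1 := hmain n (by omega) (fun f i => ∑ ψ : AddChar G ℂ,
      ∏ j, ∫ ω, ψ ((Γ ω).deg i j • (f i - f j)) ∂μ) fun f i =>
        norm_sum_prod_integral_sub_one_le (y := fun i j ω => (Γ ω).deg i j)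
          (fun i j hij ψ g hg => hchar Ω μ _ (hΓ.measurable i j) (hΓ.balanced i j hij) ψ g hg) f i
    have h2 := integral_numSur (G := G) (by omega) hΓ
    rw [← Real.norm_eq_abs, ← Complex.norm_real, Complex.ofReal_sub, h2, Complex.ofReal_inv,
      Complex.ofReal_natCast, ← mul_sub_one, norm_mul, norm_inv, Complex.norm_natCast]
    calc _ ≤ 1 * (K * Real.exp (-c * n)) := mul_le_mul hinv h1 (norm_nonneg _) zero_le_one
      _ ≤ _ := by
        rw [one_mul]
        refine mul_le_mul_of_nonneg_right ?_ (Real.exp_pos _).le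
        have : 0 ≤ ((Fintype.card G : ℝ) ^ n₀ + 1) * Real.exp (c * n₀) := by positivity
        linarith
  · have h1 : ∫ ω, (numSur (Γ ω).TotalSandpile G : ℝ) ∂μ ≤ (Fintype.card G : ℝ) ^ n₀ := by
      have h2 : ∫ ω, (numSur (Γ ω).TotalSandpile G : ℝ) ∂μ
          ≤ ∫ _, (Fintype.card G : ℝ) ^ n₀ ∂μ := by
        refine integral_mono (integrable_numSur hΓ.measurable) (integrable_const _) fun ω => ?_
        have h3 : (numSur (Γ ω).TotalSandpile G : ℝ) ≤ (Fintype.card G : ℝ) ^ n := by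
          exact_mod_cast numSur_le_pow (G := G) (Γ ω)
        exact h3.trans (pow_le_pow_right₀ hN (by omega))
      simpa using h2
    have h0 : 0 ≤ ∫ ω, (numSur (Γ ω).TotalSandpile G : ℝ) ∂μ :=
      integral_nonneg fun ω => Nat.cast_nonneg _
    have h3 : |(∫ ω, (numSur (Γ ω).TotalSandpile G : ℝ) ∂μ) - (Fintype.card G : ℝ)⁻¹|
        ≤ (Fintype.card G : ℝ) ^ n₀ + 1 := by
      rw [abs_le]
      constructor <;> linarith [pow_pos (zero_lt_one.trans_le hN) n₀]
    refine h3.trans ?_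
    have h4 : 1 ≤ Real.exp (c * n₀) * Real.exp (-c * n) := by
      rw [← Real.exp_add, Real.one_le_exp_iff]
      have : (n : ℝ) ≤ n₀ := by exact_mod_cast Nat.lt_succ_iff.mp hn
      nlinarith
    have h5 : 0 ≤ K * Real.exp (-c * n) := by positivity
    have h6 : (0 : ℝ) ≤ (Fintype.card G : ℝ) ^ n₀ + 1 := by positivity
    rw [add_mul, mul_assoc]
    nlinarith
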